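/- There do not exist smooth nonconstant functions $f:\mathbb R\to\mathbb R\setminus\{0\}$ and $h:\mathbb R^2\to\mathbb R\setminus\{0\}$ such that the sequential warped product metric $$g=(dx^1)^2+f(x^1)^2\,(dx^2)^2+h(x^1,x^2)^2\,(dx^3)^2$$ on $\mathbb R^3$ is flat, i.e. such that its Riemann curvature tensor $R(X,Y)Z=\nabla_X\nabla_YZ-\nabla_Y\nabla_XZ-\nabla_{[X,Y]}Z$, where $\nabla$ is the Levi-Civita connection of $g$, vanishes identically on $\mathbb R^3$. -/

import Mathlib

open scoped ContDiff

noncomputable section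

/-- Partial derivative `∂φ/∂xⁱ` of a function on `ℝⁿ`. -/
def partialDeriv {n : ℕ} (i : Fin n) (φ : (Fin n → ℝ) → ℝ) (x : Fin n → ℝ) : ℝ :=
  fderiv ℝ φ x (Pi.single i 1)

/-- Christoffel symbols of the second kind `Γᵏᵢⱼ = ½ ∑ₗ gᵏˡ (∂ᵢ gⱼₗ + ∂ⱼ gᵢₗ - ∂ₗ gᵢⱼ)` of a
Riemannian metric `∑ gᵢⱼ dxⁱ dxʲ` on `ℝⁿ`, given by the matrix function `g` of its components in
the standard coordinates. -/
def christoffel {n : ℕ} (g : (Fin n → ℝ) → Matrix (Fin n) (Fin n) ℝ)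
    (k i j : Fin n) (x : Fin n → ℝ) : ℝ :=
  (1 / 2) * ∑ l, (g x)⁻¹ k l *
    (partialDeriv i (fun y => g y j l) x + partialDeriv j (fun y => g y i l) x
      - partialDeriv l (fun y => g y i j) x)

/-- The Levi-Civita connection of `g`: the vector field `∇_X Y`, with components
`(∇_X Y)ᵏ = X(Yᵏ) + ∑ᵢⱼ Γᵏᵢⱼ Xⁱ Yʲ`. -/
def leviCivita {n : ℕ} (g : (Fin n → ℝ) → Matrix (Fin n) (Fin n) ℝ)
    (X Y : (Fin n → ℝ) → (Fin n → ℝ)) : (Fin n → ℝ) → (Fin n → ℝ) :=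
  fun x k => fderiv ℝ Y x (X x) k + ∑ i, ∑ j, christoffel g k i j x * X x i * Y x j

/-- The Riemann curvature `R(X,Y)Z = ∇_X ∇_Y Z - ∇_Y ∇_X Z - ∇_{[X,Y]} Z` of `g`. -/
def riemannCurvature {n : ℕ} (g : (Fin n → ℝ) → Matrix (Fin n) (Fin n) ℝ)
    (X Y Z : (Fin n → ℝ) → (Fin n → ℝ)) : (Fin n → ℝ) → (Fin n → ℝ) :=
  fun x => leviCivita g X (leviCivita g Y Z) x - leviCivita g Y (leviCivita g X Z) x
    - leviCivita g (VectorField.lieBracket ℝ X Y) Z x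

/-- The metric `g` is flat: `R(X,Y)Z = 0` for all smooth vector fields `X`, `Y`, `Z`. -/
def IsFlatMetric {n : ℕ} (g : (Fin n → ℝ) → Matrix (Fin n) (Fin n) ℝ) : Prop :=
  ∀ X Y Z : (Fin n → ℝ) → (Fin n → ℝ), ContDiff ℝ ∞ X → ContDiff ℝ ∞ Y → ContDiff ℝ ∞ Z →
    ∀ x, riemannCurvature g X Y Z x = 0

/-- The sequential warped product metric `(dx¹)² + f(x¹)² (dx²)² + h(x¹,x²)² (dx³)²` of
`(ℝ ×_f ℝ) ×_h ℝ`, as a matrix function on `ℝ³` (the coordinates `x¹, x², x³` are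
`x 0, x 1, x 2`). -/
def seqWarpedMetric (f : ℝ → ℝ) (h : ℝ × ℝ → ℝ) :
    (Fin 3 → ℝ) → Matrix (Fin 3) (Fin 3) ℝ :=
  fun x => Matrix.diagonal ![1, f (x 0) ^ 2, h (x 0, x 1) ^ 2]

end

/-! The slices with `x 2` fixed are totally geodesic surfaces with metric `(dx¹)² + f² (dx²)²`,
whose Gaussian curvature is `-f''/f`. Flatness in the `x 0`, `x 1` directions therefore forces `f''
= 0` (`riemannCurvature_seqWarpedMetric`). So `f` is affine on the whole line, and an affine
function without zeros is constant (`exists_eq_const_of_deriv_deriv_eq_zero`). -/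

/-- In an orthogonal metric the sum defining a Christoffel symbol has only one term. -/
lemma christoffel_of_eq_diagonal {n : ℕ} {g : (Fin n → ℝ) → Matrix (Fin n) (Fin n) ℝ}
    {d : Fin n → ℝ} {x : Fin n → ℝ} (hg : g x = Matrix.diagonal d) (hd : ∀ i, d i ≠ 0)
    (k i j : Fin n) :
    christoffel g k i j x = (1 / 2) * ((d k)⁻¹ *
      (partialDeriv i (fun y => g y j k) x + partialDeriv j (fun y => g y i k) x
        - partialDeriv k (fun y => g y i j) x)) := by
  have hinv : (g x)⁻¹ = Matrix.diagonal (fun i => (d i)⁻¹) := by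
    apply Matrix.inv_eq_right_inv
    rw [hg, Matrix.diagonal_mul_diagonal, ← Matrix.diagonal_one]
    congr 1
    funext i
    exact mul_inv_cancel₀ (hd i)
  unfold christoffel
  rw [hinv, Finset.sum_eq_single k]
  · rw [Matrix.diagonal_apply_eq]
  · intro l _ hl
    rw [Matrix.diagonal_apply_ne _ hl.symm, zero_mul]
  · simp

lemma partialDeriv_const {n : ℕ} (i : Fin n) (c : ℝ) (x : Fin n → ℝ) :
    partialDeriv i (fun _ => c) x = 0 := by
  simp [partialDeriv]

lemma hasFDerivAt_comp_apply {n : ℕ} {φ : ℝ → ℝ} {φ' : ℝ} {x : Fin n → ℝ} (j : Fin n)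
    (hφ : HasDerivAt φ φ' (x j)) :
    HasFDerivAt (fun y : Fin n → ℝ => φ (y j))
      (φ' • ContinuousLinearMap.proj (R := ℝ) (φ := fun _ : Fin n => ℝ) j) x :=
  hφ.comp_hasFDerivAt x (hasFDerivAt_apply j x)

lemma partialDeriv_comp_apply {n : ℕ} {φ : ℝ → ℝ} {φ' : ℝ} {x : Fin n → ℝ} (i j : Fin n)
    (hφ : HasDerivAt φ φ' (x j)) :
    partialDeriv i (fun y => φ (y j)) x = if i = j then φ' else 0 := by
  rw [partialDeriv, (hasFDerivAt_comp_apply j hφ).fderiv]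
  by_cases hij : i = j
  · subst hij; simp
  · simp [hij, Ne.symm hij]

/-- The covariant derivative of a coordinate field along a coordinate field is given by the
Christoffel symbols. -/
lemma leviCivita_single_single {n : ℕ} (g : (Fin n → ℝ) → Matrix (Fin n) (Fin n) ℝ)
    (i j : Fin n) :
    leviCivita g (fun _ => Pi.single i 1) (fun _ => Pi.single j 1)
      = fun x k => christoffel g k i j x := by
  funext x k
  simp [leviCivita, Pi.single_apply]

lemma leviCivita_zero_left {n : ℕ} (g : (Fin n → ℝ) → Matrix (Fin n) (Fin n) ℝ)
    (Z : (Fin n → ℝ) → (Fin n → ℝ)) : leviCivita g 0 Z = 0 := by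
  funext x k
  simp [leviCivita]

/-- The covariant derivative, along a coordinate field, of a field whose only nonzero component
is a function of one coordinate. -/
lemma leviCivita_single_comp_apply {n : ℕ} (g : (Fin n → ℝ) → Matrix (Fin n) (Fin n) ℝ)
    (i j m k : Fin n) {φ : ℝ → ℝ} {φ' : ℝ} {x : Fin n → ℝ} (hφ : HasDerivAt φ φ' (x m)) :
    leviCivita g (fun _ => Pi.single i 1) (fun y => Pi.single j (φ (y m))) x k
      = (if k = j ∧ i = m then φ' else 0) + christoffel g k i j x * φ (x m) := by
  have h1 : fderiv ℝ (fun y : Fin n → ℝ => (Pi.single j (φ (y m)) : Fin n → ℝ)) x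
      (Pi.single i 1) k = if k = j ∧ i = m then φ' else 0 := by
    have hF : HasFDerivAt (fun y : Fin n → ℝ => (Pi.single j (φ (y m)) : Fin n → ℝ))
        ((ContinuousLinearMap.single ℝ (fun _ : Fin n => ℝ) j).comp
          (φ' • ContinuousLinearMap.proj (R := ℝ) (φ := fun _ : Fin n => ℝ) m)) x :=
      (ContinuousLinearMap.single ℝ (fun _ : Fin n => ℝ) j).hasFDerivAt.comp x
        (hasFDerivAt_comp_apply m hφ)
    rw [hF.fderiv]
    by_cases hk : k = j <;> by_cases hi : i = m <;>
      simp [hk, hi, eq_comm]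
  simp [leviCivita, h1, Pi.single_apply]

section SeqWarped

variable {f : ℝ → ℝ} {h : ℝ × ℝ → ℝ}

lemma seqWarpedMetric_apply_ne (f : ℝ → ℝ) (h : ℝ × ℝ → ℝ) {i j : Fin 3} (hij : i ≠ j) :
    (fun y => seqWarpedMetric f h y i j) = fun _ => 0 := by
  funext y
  exact Matrix.diagonal_apply_ne _ hij

lemma seqWarpedMetric_zero_zero (f : ℝ → ℝ) (h : ℝ × ℝ → ℝ) :
    (fun y => seqWarpedMetric f h y 0 0) = fun _ => 1 := by
  funext y
  simp [seqWarpedMetric]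

lemma partialDeriv_seqWarpedMetric_one_one (hf : Differentiable ℝ f) (i : Fin 3)
    (x : Fin 3 → ℝ) :
    partialDeriv i (fun y => seqWarpedMetric f h y 1 1) x
      = if i = 0 then 2 * f (x 0) * deriv f (x 0) else 0 := by
  have hfun : (fun y => seqWarpedMetric f h y 1 1) = fun y => (fun s => f s ^ 2) (y 0) := by
    funext y
    simp [seqWarpedMetric]
  have hder : HasDerivAt (fun s => f s ^ 2) (2 * f (x 0) * deriv f (x 0)) (x 0) := by
    simpa using (hf (x 0)).hasDerivAt.fun_pow 2
  rw [hfun]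
  exact partialDeriv_comp_apply i 0 hder

lemma christoffel_seqWarpedMetric (hf0 : ∀ s, f s ≠ 0) (hh0 : ∀ p, h p ≠ 0) (k i j : Fin 3)
    (x : Fin 3 → ℝ) :
    christoffel (seqWarpedMetric f h) k i j x
      = (1 / 2) * ((![1, f (x 0) ^ 2, h (x 0, x 1) ^ 2] k)⁻¹ *
      (partialDeriv i (fun y => seqWarpedMetric f h y j k) x
        + partialDeriv j (fun y => seqWarpedMetric f h y i k) x
        - partialDeriv k (fun y => seqWarpedMetric f h y i j) x)) := by
  have hg : seqWarpedMetric f h x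
      = Matrix.diagonal ![1, f (x 0) ^ 2, h (x 0, x 1) ^ 2] := by
    rw [seqWarpedMetric]
  refine christoffel_of_eq_diagonal hg (fun l => ?_) k i j
  fin_cases l <;> simp [hf0, hh0]

/-- Only `∂₀ g₁₁ = 2 f f'` is nonzero here, and it enters only for `k = 0`. The `Pi.single` form is
the shape that `leviCivita_single_comp_apply` differentiates. -/
lemma christoffel_seqWarpedMetric_one_one (hf : Differentiable ℝ f) (hf0 : ∀ s, f s ≠ 0)
    (hh0 : ∀ p, h p ≠ 0) (k : Fin 3) (x : Fin 3 → ℝ) :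
    christoffel (seqWarpedMetric f h) k 1 1 x
      = (Pi.single 0 (-(f (x 0) * deriv f (x 0))) : Fin 3 → ℝ) k := by
  rw [christoffel_seqWarpedMetric hf0 hh0, partialDeriv_seqWarpedMetric_one_one hf]
  fin_cases k
  · simp [seqWarpedMetric_apply_ne, partialDeriv_const]
    ring
  · simp [partialDeriv_seqWarpedMetric_one_one hf]
  · simp [seqWarpedMetric_apply_ne, partialDeriv_const]

lemma christoffel_seqWarpedMetric_zero_one (hf : Differentiable ℝ f) (hf0 : ∀ s, f s ≠ 0)
    (hh0 : ∀ p, h p ≠ 0) (k : Fin 3) (x : Fin 3 → ℝ) :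
    christoffel (seqWarpedMetric f h) k 0 1 x
      = (Pi.single 1 (deriv f (x 0) / f (x 0)) : Fin 3 → ℝ) k := by
  rw [christoffel_seqWarpedMetric hf0 hh0]
  fin_cases k
  · simp [seqWarpedMetric_apply_ne, seqWarpedMetric_zero_zero, partialDeriv_const]
  · simp [seqWarpedMetric_apply_ne, partialDeriv_const, partialDeriv_seqWarpedMetric_one_one hf]
    have := hf0 (x 0)
    field_simp
  · simp [seqWarpedMetric_apply_ne, partialDeriv_const]

lemma christoffel_seqWarpedMetric_zero_zero_zero (hf0 : ∀ s, f s ≠ 0) (hh0 : ∀ p, h p ≠ 0)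
    (x : Fin 3 → ℝ) : christoffel (seqWarpedMetric f h) 0 0 0 x = 0 := by
  rw [christoffel_seqWarpedMetric hf0 hh0]
  simp [seqWarpedMetric_zero_zero, partialDeriv_const]

/-- The first component of `R(∂₁,∂₂)∂₂` is `-f f''`. -/
lemma riemannCurvature_seqWarpedMetric (hf : ContDiff ℝ ∞ f) (hf0 : ∀ s, f s ≠ 0)
    (hh0 : ∀ p, h p ≠ 0) (x : Fin 3 → ℝ) :
    riemannCurvature (seqWarpedMetric f h) (fun _ => Pi.single 0 1) (fun _ => Pi.single 1 1)
      (fun _ => Pi.single 1 1) x 0 = -(f (x 0) * deriv (deriv f) (x 0)) := by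
  have hd : Differentiable ℝ f := hf.differentiable (by simp)
  have hd' : Differentiable ℝ (deriv f) :=
    (hf.iterate_deriv 1).differentiable (by simp)
  have h11 : leviCivita (seqWarpedMetric f h) (fun _ => Pi.single 1 1) (fun _ => Pi.single 1 1)
      = fun y => Pi.single 0 ((fun s => -(f s * deriv f s)) (y 0)) := by
    rw [leviCivita_single_single]
    funext y k
    exact christoffel_seqWarpedMetric_one_one hd hf0 hh0 k y
  have h01 : leviCivita (seqWarpedMetric f h) (fun _ => Pi.single 0 1) (fun _ => Pi.single 1 1)
      = fun y => Pi.single 1 ((fun s => deriv f s / f s) (y 0)) := by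
    rw [leviCivita_single_single]
    funext y k
    exact christoffel_seqWarpedMetric_zero_one hd hf0 hh0 k y
  have hbr : VectorField.lieBracket ℝ (fun _ : Fin 3 → ℝ => (Pi.single 0 1 : Fin 3 → ℝ))
      (fun _ => Pi.single 1 1) = 0 := by
    funext y
    simp [VectorField.lieBracket]
  have e1 := ((hd (x 0)).hasDerivAt.fun_mul (hd' (x 0)).hasDerivAt).fun_neg
  have e2 := (hd' (x 0)).hasDerivAt.fun_div (hd (x 0)).hasDerivAt (hf0 _)
  rw [riemannCurvature, hbr, leviCivita_zero_left, h11, h01, Pi.sub_apply, Pi.sub_apply,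
    leviCivita_single_comp_apply _ 0 0 0 0 e1, leviCivita_single_comp_apply _ 1 1 0 0 e2,
    christoffel_seqWarpedMetric_zero_zero_zero hf0 hh0,
    christoffel_seqWarpedMetric_one_one hd hf0 hh0]
  -- The two second covariant derivatives contribute `-(f'² + f f'')` and `(-f f') (f'/f) = -f'²`;
  -- the `f'²` terms cancel in the difference.
  have := hf0 (x 0)
  simp
  field_simp
  ring

end SeqWarped

/-- A nowhere vanishing real function with zero second derivative is constant. -/
lemma exists_eq_const_of_deriv_deriv_eq_zero {f : ℝ → ℝ} (hf : Differentiable ℝ f)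
    (hf' : Differentiable ℝ (deriv f)) (hf0 : ∀ s, f s ≠ 0)
    (hf2 : ∀ s, deriv (deriv f) s = 0) : ∃ c, ∀ s, f s = c := by
  have hc : ∀ s, deriv f s = deriv f 0 := fun s => is_const_of_deriv_eq_zero hf' hf2 s 0
  have haff : ∀ s, f s - deriv f 0 * s = f 0 := by
    intro s
    have hder : ∀ t, HasDerivAt (fun t => f t - deriv f 0 * t) 0 t := by
      intro t
      have := (hf t).hasDerivAt.fun_sub ((hasDerivAt_id' t).const_mul (deriv f 0))
      simpa [hc t] using this
    simpa using is_const_of_deriv_eq_zero (fun t => (hder t).differentiableAt)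
      (fun t => (hder t).deriv) s 0
  by_cases h0 : deriv f 0 = 0
  · exact ⟨f 0, fun s => by simpa [h0] using haff s⟩
  -- With nonzero slope, this point is the root of the affine function `f 0 + f' 0 * s`.
  · refine absurd ?_ (hf0 (-f 0 / deriv f 0))
    have := haff (-f 0 / deriv f 0)
    rw [mul_div_cancel₀ _ h0] at this
    linarith

theorem corollary3p10 :
    ¬ ∃ (f : ℝ → ℝ) (h : ℝ × ℝ → ℝ),
      ContDiff ℝ ∞ f ∧ ContDiff ℝ ∞ h ∧
      (∀ s, f s ≠ 0) ∧ (∀ p, h p ≠ 0) ∧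
      (¬ ∃ c, ∀ s, f s = c) ∧ (¬ ∃ c, ∀ p, h p = c) ∧
      IsFlatMetric (seqWarpedMetric f h) := by
  rintro ⟨f, h, hf, -, hf0, hh0, hfc, -, hflat⟩
  refine hfc (exists_eq_const_of_deriv_deriv_eq_zero (hf.differentiable (by simp))
    ((hf.iterate_deriv 1).differentiable (by simp)) hf0 fun s => ?_)
  -- Only the coordinate `x 0` matters, so the point `(s, s, s)` serves for each `s`.
  have hR := congrFun (hflat (fun _ => Pi.single 0 1) (fun _ => Pi.single 1 1)
    (fun _ => Pi.single 1 1) contDiff_const contDiff_const contDiff_const (fun _ => s)) 0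
  rw [riemannCurvature_seqWarpedMetric hf hf0 hh0] at hR
  simpa [hf0 s] using hR
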